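/- Let $n\ge 1$. Let $\mathbb{T}_n(\mathbb{R})$ be the set of real lower triangular $n\times n$ matrices all of whose diagonal entries are equal, and let $\mathbb{T}_n^*(\mathbb{R})$ be the group of those with non-zero diagonal entry. Let $\mathbb{S}$ be the set of real matrices of the form $\begin{bmatrix}\alpha&\beta\\-\beta&\alpha\end{bmatrix}$, let $\mathbb{B}_n(\mathbb{R})$ be the set of real $2n\times 2n$ matrices that are block lower triangular with $2\times 2$ blocks in $\mathbb{S}$ and with all $n$ diagonal blocks equal, and let $\mathbb{B}_n^*(\mathbb{R})=\mathbb{B}_n(\mathbb{R})\cap \mathrm{GL}(2n,\mathbb{R})$. A subgroup $G$ of $\mathrm{GL}(m,\mathbb{R})$ is called topologically transitive if for some $v\in\mathbb{R}^m$ the orbit $\{Av: A\in G\}$ is dense in $\mathbb{R}^m$. Let $e_1$ be the first vector of the canonical basis. (i) Let $G$ be an abelian subgroup of $\mathbb{B}_n^*(\mathbb{R})$, and put $\mathrm{g}=\{B\in\mathbb{B}_n(\mathbb{R}): e^B\in G\}$ and $\mathrm{g}_{e_1}=\{Be_1: B\in \mathrm{g}\}$. If $\mathrm{g}_{e_1}$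 is dense in $\mathbb{R}^{2n}$, then $G$ is topologically transitive. (ii) Let $G$ be an abelian subgroup of $\mathbb{T}_n^*(\mathbb{R})$, and put $\mathrm{g}=\{B\in\mathbb{T}_n(\mathbb{R}): e^B\in G\}$ and $\mathrm{g}_{e_1}=\{Be_1: B\in \mathrm{g}\}$. Let $\mathrm{ind}(G)=1$ if some element of $G$ has a negative diagonal entry, and $\mathrm{ind}(G)=0$ otherwise. If $\mathrm{g}_{e_1}$ is dense in $\mathbb{R}^n$ and $\mathrm{ind}(G)=1$, then $G$ is topologically transitive. -/

import Mathlib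

open Matrix

namespace AbelianLinear

/-- `M` is lower triangular with all diagonal entries equal to `μ`. -/
def IsLowerTriangularWith {n : ℕ} (μ : ℝ) (M : Matrix (Fin n) (Fin n) ℝ) : Prop :=
  (∀ i, M i i = μ) ∧ ∀ i j, i < j → M i j = 0

/-- `𝕋_n(ℝ)`: lower triangular real matrices with constant diagonal. -/
def setT (n : ℕ) : Set (Matrix (Fin n) (Fin n) ℝ) :=
  {M | ∃ μ : ℝ, IsLowerTriangularWith μ M}

/-- `𝕋_n^*(ℝ)`: those elements of `𝕋_n(ℝ)` whose diagonal entry is non-zero. -/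
def setTStar (n : ℕ) : Set (GL (Fin n) ℝ) :=
  {A | ∃ μ : ℝ, μ ≠ 0 ∧ IsLowerTriangularWith μ (A : Matrix (Fin n) (Fin n) ℝ)}

/-- `𝕊`: the real `2 × 2` matrices of the form `[[α, β], [-β, α]]`. -/
def setS : Set (Matrix (Fin 2) (Fin 2) ℝ) :=
  {C | ∃ α β : ℝ, C = !![α, β; -β, α]}

/-- The `(i, j)` block of size `2 × 2` of a matrix of size `2n × 2n`. -/
def block {n : ℕ} (M : Matrix (Fin (2 * n)) (Fin (2 * n)) ℝ) (i j : Fin n) :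
    Matrix (Fin 2) (Fin 2) ℝ :=
  Matrix.of fun a b : Fin 2 =>
    M ⟨2 * (i : ℕ) + a, by omega⟩ ⟨2 * (j : ℕ) + b, by omega⟩

/-- `𝔹_n(ℝ)`: the real `2n × 2n` matrices that are block lower triangular with `2 × 2` blocks
in `𝕊` and with all diagonal blocks equal to one and the same `C ∈ 𝕊`. -/
def setB (n : ℕ) : Set (Matrix (Fin (2 * n)) (Fin (2 * n)) ℝ) :=
  {M | ∃ C ∈ setS, (∀ i, block M i i = C) ∧
    (∀ i j, i < j → block M i j = 0) ∧ ∀ i j, j < i → block M i j ∈ setS}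

/-- `𝔹_n^*(ℝ)`: the invertible elements of `𝔹_n(ℝ)`. -/
def setBStar (n : ℕ) : Set (GL (Fin (2 * n)) ℝ) :=
  {A | (A : Matrix (Fin (2 * n)) (Fin (2 * n)) ℝ) ∈ setB n}

/-- The set `g = exp⁻¹(G) ∩ K` of a group `G` of invertible matrices contained in the matrix
space `K`. -/
def logSet {m : ℕ} (K : Set (Matrix (Fin m) (Fin m) ℝ)) (G : Subgroup (GL (Fin m) ℝ)) :
    Set (Matrix (Fin m) (Fin m) ℝ) :=
  {B | (∃ A ∈ G, NormedSpace.exp B = (A : Matrix (Fin m) (Fin m) ℝ)) ∧ B ∈ K}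

/-- `g_u = {B u : B ∈ g}`. -/
def evalSet {m : ℕ} (g : Set (Matrix (Fin m) (Fin m) ℝ)) (u : Fin m → ℝ) : Set (Fin m → ℝ) :=
  {w | ∃ B ∈ g, w = B *ᵥ u}

/-- The orbit `G(v) = {A v : A ∈ G}`. -/
def orbit {m : ℕ} (G : Subgroup (GL (Fin m) ℝ)) (v : Fin m → ℝ) : Set (Fin m → ℝ) :=
  {w | ∃ A ∈ G, w = (A : Matrix (Fin m) (Fin m) ℝ) *ᵥ v}

/-- `G` is topologically transitive: its linear action on `ℝ^m` has a dense orbit. -/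
def TopologicallyTransitive {m : ℕ} (G : Subgroup (GL (Fin m) ℝ)) : Prop :=
  ∃ v : Fin m → ℝ, Dense (orbit G v)

open Classical in
/-- The index attached to the set `S` of the tuples `(μ_1, …, μ_r)` of eigenvalues on the `r` real
blocks, one tuple for each element of the group. -/
noncomputable def signIndex : (r : ℕ) → Set (Fin r → ℝ) → ℕ
  | 0, _ => 0
  | 1, S => if ∃ μ ∈ S, μ 0 < 0 then 1 else 0
  | r + 2, S => Set.ncard {k : Fin (r + 2) | ∃ μ ∈ S, μ k < 0 ∧ ∀ i, i ≠ k → 0 < μ i}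

/-- The index `ind(G)` of a subgroup `G` of `𝕋_n^*(ℝ)`. There is a single real block here (`r = 1`),
and the eigenvalue of a matrix on it is its constant diagonal entry. -/
noncomputable def indexT {n : ℕ} (G : Subgroup (GL (Fin n) ℝ)) : ℕ :=
  signIndex 1 {μ | ∃ A ∈ G, IsLowerTriangularWith (μ 0) (A : Matrix (Fin n) (Fin n) ℝ)}

/-- The first vector `e_1` of the canonical basis of `ℝ^m`, where `m ≥ 1`. -/
def firstBasisVector (m : ℕ) (hm : 1 ≤ m) : Fin m → ℝ :=
  Pi.single ⟨0, hm⟩ 1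

end AbelianLinear

/-! Each matrix of `setB n` or `setT n` is a nilpotent plus a scalar (complex, resp. real) commuting
with that whole space. As `exp N` determines a nilpotent `N` polynomially, the logarithms `g` of the
abelian group commute with each other. Inside the algebra of such matrices, let `V` be the commutant
of `g`. Density of `g e₁` makes `B ↦ B e₁` a linear bijection from `V` onto the space. With inverse
`y ↦ B_y`, the map `y ↦ exp(B_y) e₁` is continuous and sends `g e₁` into the orbit of `e₁`, hence
every `y` into its closure. Every `B ∈ V` whose scalar part is an exponential is itself the
exponential of an element of `V`, so `B e₁` lies in that closure (`mem_closure_orbit`). Over `ℂ`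
this reaches every vector with nonzero first coordinate. Over `ℝ` it reaches those with positive
first coordinate, and an element of `G` with negative diagonal entry supplies the opposite
half-space. -/

namespace AbelianLinear

/-! ### Exponentials and logarithms of nilpotent perturbations -/

section Exponential

variable {m : ℕ}

local notation "Mat" => Matrix (Fin m) (Fin m) ℝ

open Polynomial in
theorem exists_polynomial_exp_eq {N : Mat} (hN : IsNilpotent N) :
    ∃ w : ℝ[X], NormedSpace.exp N = 1 + N + N ^ 2 * aeval N w := by
  obtain ⟨k, hk⟩ := hN
  refine ⟨∑ i ∈ Finset.range k, C (((i + 2).factorial : ℝ)⁻¹) * X ^ i, ?_⟩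
  rw [NormedSpace.exp_eq_tsum ℝ]
  beta_reduce
  rw [tsum_eq_sum (s := Finset.range (k + 2)), Finset.sum_range_succ', Finset.sum_range_succ']
  · simp only [map_sum, map_mul, aeval_C, map_pow, aeval_X, Finset.mul_sum, Algebra.algebraMap_eq_smul_one]
    simp only [smul_mul_assoc, one_mul, mul_smul_comm, ← pow_add]
    simp only [zero_add, Nat.factorial_one, Nat.factorial_zero, Nat.cast_one, inv_one, one_smul,
      pow_one, pow_zero, add_assoc, Nat.reduceAdd, add_comm 2]
    abel
  · intro i hi
    rw [pow_eq_zero_of_le (by simp at hi; omega) hk, smul_zero]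

-- Descending induction on `j`: `Y` commutes with `N ^ j * ℝ[N]`, trivially once `j ≥ k`. Since
-- `(exp N - 1) ^ j = N ^ j * (1 + N * r(N))`, the power `N ^ j` differs from a matrix commuting
-- with `Y` by an element of the next ideal.
open Polynomial in
theorem commute_of_commute_exp_of_isNilpotent {N Y : Mat} (hN : IsNilpotent N)
    (h : Commute Y (NormedSpace.exp N)) : Commute Y N := by
  obtain ⟨w, hw⟩ := exists_polynomial_exp_eq hN
  obtain ⟨k, hk⟩ := hN
  have key : ∀ s j : ℕ, k ≤ j + s → ∀ q : ℝ[X], Commute Y (N ^ j * aeval N q) := by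
    intro s
    induction s with
    | zero =>
      intro j hj q
      rw [pow_eq_zero_of_le (by omega) hk, zero_mul]
      exact Commute.zero_right _
    | succ s ih =>
      intro j hj q
      have hD : Commute Y ((NormedSpace.exp N - 1) ^ j) :=
        (h.sub_right (Commute.one_right Y)).pow_right j
      have hDN : (NormedSpace.exp N - 1) ^ j = N ^ j * aeval N ((1 + X * w) ^ j) := by
        have h1 : NormedSpace.exp N - 1 = aeval N (X * (1 + X * w)) := by
          rw [hw]; simp only [map_mul, map_add, map_one, aeval_X]; noncomm_ring
        rw [h1, ← map_pow, mul_pow, map_mul, map_pow, aeval_X]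
      obtain ⟨r, hr⟩ : ∃ r : ℝ[X], (1 + X * w) ^ j = 1 + X * r := by
        obtain ⟨r, hr⟩ := X_dvd_iff.2 (show ((1 + X * w) ^ j - 1 : ℝ[X]).coeff 0 = 0 by
          simp [coeff_zero_eq_eval_zero])
        exact ⟨r, by rw [← hr]; ring⟩
      have hNj : Commute Y (N ^ j) := by
        have : N ^ j = (NormedSpace.exp N - 1) ^ j - N ^ (j + 1) * aeval N r := by
          rw [hDN, hr]; simp only [map_add, map_mul, map_one, aeval_X, pow_succ]; noncomm_ring
        rw [this]
        exact hD.sub_right (ih (j + 1) (by omega) r)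
      have hq : N ^ j * aeval N q = N ^ (j + 1) * aeval N q.divX + q.coeff 0 • N ^ j := by
        conv_lhs => rw [← divX_mul_X_add q]
        rw [map_add, mul_comm q.divX X, map_mul, aeval_X, aeval_C, mul_add, ← mul_assoc, ← pow_succ,
          Algebra.algebraMap_eq_smul_one, mul_smul_comm, mul_one]
      rw [hq]
      exact (ih (j + 1) (by omega) _).add_right (hNj.smul_right _)
  simpa using key k 1 (by omega) 1

/-- Successive approximation: `(1 + N) * exp (-N) = 1 + N ^ 2 * R`, so `N` is a first approximation
to the logarithm, and the remaining error has smaller nilpotency index. -/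
theorem exists_exp_eq_one_add_of_isNilpotent {A : Subalgebra ℝ Mat}
    (hA : ∀ a ∈ A, ∀ b ∈ A, a * b = b * a) {N : Mat} (hNA : N ∈ A) (hN : IsNilpotent N) :
    ∃ L ∈ A, NormedSpace.exp L = 1 + N := by
  obtain ⟨k, hk⟩ := hN
  induction k generalizing N with
  | zero =>
    refine ⟨0, A.zero_mem, ?_⟩
    have h0 : N = 0 := by rw [← mul_one N, ← pow_zero N, hk, mul_zero]
    simp [h0]
  | succ k ih =>
    -- `(N ^ 2) ^ k = 0` needs `2 * k ≥ k + 1`, which fails only for `k = 0`.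
    rcases Nat.eq_zero_or_pos k with rfl | hkpos
    · refine ⟨0, A.zero_mem, ?_⟩
      rw [zero_add, pow_one] at hk
      simp [hk]
    obtain ⟨w, hw⟩ := exists_polynomial_exp_eq (N := -N) (IsNilpotent.neg ⟨_, hk⟩)
    set W := Polynomial.aeval (-N) w
    have hWA : W ∈ A := Algebra.adjoin_le (S := A) (by simpa using hNA)
      (Polynomial.aeval_mem_adjoin_singleton ℝ (-N))
    have hNW : Commute N W := hA _ hNA _ hWA
    set R := -1 + W + N * W
    have hRA : R ∈ A := A.add_mem (A.add_mem (A.neg_mem A.one_mem) hWA) (A.mul_mem hNA hWA)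
    have hR : (1 + N) * NormedSpace.exp (-N) = 1 + N ^ 2 * R := by
      rw [hw]; simp only [R]; noncomm_ring
    obtain ⟨L, hL, hLe⟩ := ih (N := N ^ 2 * R) (A.mul_mem (A.pow_mem hNA 2) hRA) (by
      rw [(show Commute (N ^ 2) R from hA _ (A.pow_mem hNA 2) _ hRA).mul_pow, ← pow_mul,
        pow_eq_zero_of_le (by omega) hk, zero_mul])
    refine ⟨L + N, A.add_mem hL hNA, ?_⟩
    rw [Matrix.exp_add_of_commute _ _ (hA _ hL _ hNA), hLe, ← hR, mul_assoc,
      ← Matrix.exp_add_of_commute _ _ ((Commute.refl N).neg_left), neg_add_cancel,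
      NormedSpace.exp_zero, mul_one]

theorem continuous_matrix_exp : Continuous (NormedSpace.exp : Mat → Mat) :=
  open scoped Matrix.Norms.Operator in NormedSpace.exp_continuous

end Exponential

/-! ### Algebras of central scalars plus nilpotents -/

section CentralScalars

variable {m : ℕ} {𝕜 : Type*} [RCLike 𝕜] (f : 𝕜 →ₐ[ℝ] Matrix (Fin m) (Fin m) ℝ)

theorem map_exp_algHom (z : 𝕜) : f (NormedSpace.exp z) = NormedSpace.exp (f z) := by
  have hf : Continuous f := LinearMap.continuous_of_finiteDimensional f.toLinearMap
  rw [NormedSpace.exp_eq_tsum ℝ, NormedSpace.exp_eq_tsum ℝ]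
  refine ((NormedSpace.expSeries_summable' (𝕂 := ℝ) z).hasSum.map f hf).tsum_eq.symm.trans ?_
  simp

variable {K : Subalgebra ℝ (Matrix (Fin m) (Fin m) ℝ)} (hfK : ∀ z, f z ∈ K)
  (hcomm : ∀ z, ∀ B ∈ K, Commute (f z) B) (hnil : ∀ B ∈ K, ∃ z, IsNilpotent (B - f z))

include hcomm hnil in
theorem commute_of_commute_exp {A Y : Matrix (Fin m) (Fin m) ℝ} (hA : A ∈ K)
    (hY : ∀ z, Commute (f z) Y) (h : Commute Y (NormedSpace.exp A)) : Commute Y A := by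
  obtain ⟨z, hz⟩ := hnil A hA
  have hfz : Commute (f (-z)) A := hcomm _ A hA
  have h1 : NormedSpace.exp (A - f z) = NormedSpace.exp A * f (NormedSpace.exp (-z)) := by
    rw [map_exp_algHom, ← Matrix.exp_add_of_commute _ _ hfz.symm, map_neg, sub_eq_add_neg]
  have h2 : Commute Y (A - f z) := commute_of_commute_exp_of_isNilpotent hz
    (h1 ▸ h.mul_right (hY _).symm)
  simpa using h2.add_right (hY z).symm

include hfK hcomm hnil in
theorem mem_closure_orbit (G : Subgroup (GL (Fin m) ℝ)) (hG : ∀ A ∈ G, ∀ B ∈ G, A * B = B * A)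
    (g : Set (Matrix (Fin m) (Fin m) ℝ)) (hgK : ∀ B ∈ g, B ∈ K)
    (hgG : ∀ B ∈ g, ∃ A ∈ G, NormedSpace.exp B = (A : Matrix (Fin m) (Fin m) ℝ))
    (u : Fin m → ℝ) (hd : Dense (evalSet g u)) (x : Fin m → ℝ)
    (hx : ∀ B ∈ K, B *ᵥ u = x → ∃ w, IsNilpotent (B - f (NormedSpace.exp w))) :
    x ∈ closure (orbit G u) := by
  have hgcomm : ∀ A ∈ g, ∀ B ∈ g, Commute A B := by
    intro A hA B hB
    have hAB : Commute (NormedSpace.exp B) (NormedSpace.exp A) := by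
      obtain ⟨A', hA', hA'e⟩ := hgG A hA
      obtain ⟨B', hB', hB'e⟩ := hgG B hB
      rw [hA'e, hB'e]
      exact congrArg Units.val (hG B' hB' A' hA')
    have h1 : Commute (NormedSpace.exp B) A := commute_of_commute_exp f hcomm hnil (hgK A hA)
      (fun z => (hcomm z B (hgK B hB)).exp_right) hAB
    exact commute_of_commute_exp f hcomm hnil (hgK B hB) (fun z => hcomm z A (hgK A hA)) h1.symm
  let V : Subalgebra ℝ (Matrix (Fin m) (Fin m) ℝ) := K ⊓ Subalgebra.centralizer ℝ g
  have hgV : ∀ B ∈ g, B ∈ V := fun B hB =>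
    ⟨hgK B hB, Subalgebra.mem_centralizer_iff ℝ |>.2 fun C hC => hgcomm C hC B hB⟩
  let φ : V →ₗ[ℝ] (Fin m → ℝ) :=
    { toFun := fun B => (B : Matrix (Fin m) (Fin m) ℝ) *ᵥ u
      map_add' := fun A B => by simp [Matrix.add_mulVec]
      map_smul' := fun c B => by simp [Matrix.smul_mulVec] }
  -- If `C` commutes with `g` and kills `u`, it kills the dense set `g u`.
  have hinj : Function.Injective φ := by
    rw [injective_iff_map_eq_zero]
    rintro ⟨C, hCK, hC⟩ hC0
    have hC0 : C *ᵥ u = 0 := hC0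
    have h1 : (fun y => C *ᵥ y) = fun _ => (0 : Fin m → ℝ) := by
      refine Continuous.ext_on hd (by fun_prop) (by fun_prop) ?_
      rintro _ ⟨B, hB, rfl⟩
      have h2 : B * C = C * B := (Subalgebra.mem_centralizer_iff ℝ).1 hC B hB
      simp only [Matrix.mulVec_mulVec, ← h2]
      rw [← Matrix.mulVec_mulVec, hC0, Matrix.mulVec_zero]
    exact Subtype.ext (Matrix.ext_of_mulVec_single fun i => 
      (congrFun h1 (Pi.single i 1)).trans (Matrix.zero_mulVec _).symm)
  -- The range is a closed subspace containing the dense set `g u`.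
  have hsurj : Function.Surjective φ := by
    rw [← LinearMap.range_eq_top, ← SetLike.coe_set_eq, Submodule.top_coe,
      ← (Submodule.closed_of_finiteDimensional (LinearMap.range φ)).closure_eq]
    refine Dense.closure_eq (hd.mono ?_)
    rintro _ ⟨B, hB, rfl⟩
    exact ⟨⟨B, hgV B hB⟩, rfl⟩
  let ψ : V ≃ₗ[ℝ] (Fin m → ℝ) := LinearEquiv.ofBijective φ ⟨hinj, hsurj⟩
  let F : (Fin m → ℝ) → (Fin m → ℝ) := fun y =>
    NormedSpace.exp (ψ.symm y : Matrix (Fin m) (Fin m) ℝ) *ᵥ u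
  have hFc : Continuous F := by
    have h1 : Continuous fun y => (ψ.symm y : Matrix (Fin m) (Fin m) ℝ) :=
      LinearMap.continuous_of_finiteDimensional (V.val.toLinearMap ∘ₗ ψ.symm.toLinearMap)
    exact (continuous_matrix_exp.comp h1).matrix_mulVec continuous_const
  have hFmem : ∀ y, F y ∈ closure (orbit G u) := by
    intro y
    refine map_mem_closure hFc (hd y) ?_
    rintro _ ⟨B, hB, rfl⟩
    obtain ⟨A, hA, hAe⟩ := hgG B hB
    refine ⟨A, hA, ?_⟩
    have : ψ.symm (B *ᵥ u) = ⟨B, hgV B hB⟩ := (LinearEquiv.symm_apply_eq ψ).2 rfl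
    simp only [F, this, hAe]
  obtain ⟨⟨B, hBV⟩, hB⟩ := hsurj x
  have hB : B *ᵥ u = x := hB
  obtain ⟨w, hw⟩ := hx B hBV.1 hB
  have hfV : ∀ z, f z ∈ V := fun z => ⟨hfK z, (Subalgebra.mem_centralizer_iff ℝ).2
    fun C hC => (hcomm z C (hgK C hC)).symm⟩
  have hcB : ∀ z z', Commute (f z) (B - f z') := fun z z' =>
    (hcomm z B hBV.1).sub_right (hcomm z _ (hfK z'))
  -- Chosen so that `B = f (exp w) * (1 + N)`; the logarithm of `1 + N` is taken in `ℝ[N] ⊆ V`,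
  -- which is visibly commutative.
  set N := f (NormedSpace.exp (-w)) * (B - f (NormedSpace.exp w)) with hNdef
  have hNnil : IsNilpotent N := (hcB _ _).isNilpotent_mul_left hw
  have hNV : N ∈ V := V.mul_mem (hfV _) (V.sub_mem hBV (hfV _))
  have hprod : f (NormedSpace.exp w) * (1 + N) = B := by
    rw [hNdef, mul_add, ← mul_assoc, ← map_mul, ← NormedSpace.exp_add, add_neg_cancel,
      NormedSpace.exp_zero, map_one]
    simp
  obtain ⟨L, hL, hLe⟩ := exists_exp_eq_one_add_of_isNilpotent
    (A := Algebra.adjoin ℝ {N})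
    (fun a ha b hb => congrArg Subtype.val
      (mul_comm (⟨a, ha⟩ : Algebra.adjoin ℝ {N}) ⟨b, hb⟩))
    (Algebra.self_mem_adjoin_singleton ℝ N) hNnil
  have hLV : L ∈ V := Algebra.adjoin_le (S := V) (by simpa using hNV) hL
  have hexp : NormedSpace.exp (f w + L) = B := by
    rw [Matrix.exp_add_of_commute _ _ (hcomm w L hLV.1), ← map_exp_algHom, hLe, hprod]
  have h3 : F (φ ⟨f w + L, V.add_mem (hfV w) hLV⟩) = x := by
    have : ψ.symm (φ ⟨f w + L, V.add_mem (hfV w) hLV⟩) = ⟨f w + L, V.add_mem (hfV w) hLV⟩ :=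
      (LinearEquiv.symm_apply_eq ψ).2 rfl
    simp only [F, this, hexp, hB]
  exact h3 ▸ hFmem _

end CentralScalars
end AbelianLinear
namespace AbelianLinear

/-! ### Filtrations by level -/

section Levels

variable {m : ℕ}

/-- `M` raises the level `d` of the basis vectors by at least `k`. -/
def RaisesLevel (d : Fin m → ℕ) (k : ℕ) (M : Matrix (Fin m) (Fin m) ℝ) : Prop :=
  ∀ i j, d i < d j + k → M i j = 0

variable {d : Fin m → ℕ} {k l : ℕ} {M N : Matrix (Fin m) (Fin m) ℝ}

theorem RaisesLevel.add (hM : RaisesLevel d k M) (hN : RaisesLevel d k N) :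
    RaisesLevel d k (M + N) := fun i j h => by
  rw [Matrix.add_apply, hM i j h, hN i j h, add_zero]

theorem RaisesLevel.mul (hM : RaisesLevel d k M) (hN : RaisesLevel d l N) :
    RaisesLevel d (k + l) (M * N) := fun i j h => by
  rw [Matrix.mul_apply]
  refine Finset.sum_eq_zero fun r _ => ?_
  by_cases hr : d i < d r + k
  · rw [hM i r hr, zero_mul]
  · rw [hN r j (by omega), mul_zero]

theorem RaisesLevel.mono (hM : RaisesLevel d k M) (h : l ≤ k) : RaisesLevel d l M :=
  fun i j hij => hM i j (by omega)

theorem RaisesLevel.isNilpotent (hM : RaisesLevel d 1 M) : IsNilpotent M := by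
  have hpow : ∀ s : ℕ, RaisesLevel d s (M ^ s) := by
    intro s
    induction s with
    | zero =>
      intro i j h
      rw [pow_zero, Matrix.one_apply_ne]
      rintro rfl
      simp at h
    | succ s ih => rw [pow_succ]; exact ih.mul hM
  -- No basis vector can be raised beyond the maximal level.
  refine ⟨Finset.univ.sup d + 1, ?_⟩
  ext i j
  have := Finset.le_sup (f := d) (Finset.mem_univ i)
  exact hpow _ i j (by omega)

variable {𝕜 : Type*} [RCLike 𝕜]

/-- The matrices commuting with the scalars `f z` and equal to one of them up to a matrix that
strictly raises the level. -/
def levelSubalgebra (d : Fin m → ℕ) (f : 𝕜 →ₐ[ℝ] Matrix (Fin m) (Fin m) ℝ)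
    (hf : ∀ z, RaisesLevel d 0 (f z)) : Subalgebra ℝ (Matrix (Fin m) (Fin m) ℝ) where
  carrier := {B | (∀ z, Commute (f z) B) ∧ ∃ z, RaisesLevel d 1 (B - f z)}
  mul_mem' := by
    rintro A B ⟨hA, a, ha⟩ ⟨hB, b, hb⟩
    refine ⟨fun z => (hA z).mul_right (hB z), a * b, ?_⟩
    have hB0 : RaisesLevel d 0 B := by
      simpa using (hb.mono (Nat.zero_le 1)).add (hf b)
    have : A * B - f (a * b) = (A - f a) * B + f a * (B - f b) := by
      rw [map_mul]; noncomm_ring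
    rw [this]
    exact (ha.mul hB0).add (by simpa using (hf a).mul hb)
  add_mem' := by
    rintro A B ⟨hA, a, ha⟩ ⟨hB, b, hb⟩
    refine ⟨fun z => (hA z).add_right (hB z), a + b, ?_⟩
    rw [map_add, add_sub_add_comm]
    exact ha.add hb
  algebraMap_mem' := fun r => by
    refine ⟨fun z => (Algebra.commutes r (f z)).symm, algebraMap ℝ 𝕜 r, ?_⟩
    rw [AlgHom.commutes, sub_self]
    exact fun i j _ => rfl

theorem mem_closure_orbit_of_level (f : 𝕜 →ₐ[ℝ] Matrix (Fin m) (Fin m) ℝ)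
    (hf : ∀ z, RaisesLevel d 0 (f z)) (i₀ : Fin m)
    (hre : ∀ z, f z i₀ i₀ = RCLike.re z)
    (G : Subgroup (GL (Fin m) ℝ)) (hG : ∀ A ∈ G, ∀ B ∈ G, A * B = B * A)
    (S : Set (Matrix (Fin m) (Fin m) ℝ)) (hS : S ⊆ levelSubalgebra d f hf)
    (hdense : Dense (evalSet (logSet S G) (Pi.single i₀ 1))) (x : Fin m → ℝ)
    (hx : ∀ z : 𝕜, RCLike.re z = x i₀ → ∃ w, NormedSpace.exp w = z) :
    x ∈ closure (orbit G (Pi.single i₀ 1)) := by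
  refine mem_closure_orbit f (K := levelSubalgebra d f hf) ?_ (fun z B hB => hB.1 z)
    (fun B hB => hB.2.imp fun z hz => hz.isNilpotent) G hG (logSet S G) (fun B hB => hS hB.2)
    (fun B hB => hB.1) _ hdense x ?_
  · refine fun z => ⟨fun z' => ?_, z, ?_⟩
    · rw [Commute, SemiconjBy, ← map_mul, ← map_mul, mul_comm]
    · rw [sub_self]; exact fun i j _ => rfl
  · rintro B ⟨-, z, hz⟩ hBx
    -- A strictly level-raising matrix has zero diagonal, so this entry is the real part of the
    -- scalar part of `B`.
    have h0 : B i₀ i₀ = x i₀ := by rw [← hBx]; simp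
    obtain ⟨w, rfl⟩ := hx z (by
      rw [← h0, ← hre, eq_comm, ← sub_eq_zero, ← Matrix.sub_apply]
      exact hz _ _ (by omega))
    exact ⟨w, hz.isNilpotent⟩

end Levels

/-! ### The complex case: 2 × 2 blocks -/

section Blocks

variable {n : ℕ}

/-- The index `2 a + p` of the entry `p` of the block `a`. -/
def blockIndex : Fin n × Fin 2 ≃ Fin (2 * n) :=
  finProdFinEquiv.trans (finCongr (mul_comm n 2))

theorem block_apply (M : Matrix (Fin (2 * n)) (Fin (2 * n)) ℝ) (a b : Fin n) (p q : Fin 2) :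
    block M a b p q = M (blockIndex (a, p)) (blockIndex (b, q)) := by
  simp only [block, Matrix.of_apply]
  congr 1 <;> simp [blockIndex, Fin.ext_iff, add_comm]

theorem blockIndex_val_div (a : Fin n) (p : Fin 2) : (blockIndex (a, p) : ℕ) / 2 = a := by
  simp [blockIndex]
  omega

theorem ext_block {M N : Matrix (Fin (2 * n)) (Fin (2 * n)) ℝ}
    (h : ∀ a b, block M a b = block N a b) : M = N := by
  ext i j
  obtain ⟨⟨a, p⟩, rfl⟩ := blockIndex.surjective i
  obtain ⟨⟨b, q⟩, rfl⟩ := blockIndex.surjective j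
  simpa only [block_apply] using congrFun₂ (h a b) p q

theorem block_mul (M N : Matrix (Fin (2 * n)) (Fin (2 * n)) ℝ) (a b : Fin n) :
    block (M * N) a b = ∑ c, block M a c * block N c b := by
  ext p q
  rw [block_apply, Matrix.mul_apply, ← blockIndex.sum_comp, Fintype.sum_prod_type,
    Matrix.sum_apply]
  simp only [Matrix.mul_apply, block_apply]

/-- The block diagonal matrix all of whose diagonal blocks are `C`. -/
def blockScalar (n : ℕ) (C : Matrix (Fin 2) (Fin 2) ℝ) :
    Matrix (Fin (2 * n)) (Fin (2 * n)) ℝ :=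
  Matrix.of fun i j => if (blockIndex.symm i).1 = (blockIndex.symm j).1 then
    C (blockIndex.symm i).2 (blockIndex.symm j).2 else 0

theorem block_blockScalar (C : Matrix (Fin 2) (Fin 2) ℝ) (a b : Fin n) :
    block (blockScalar n C) a b = if a = b then C else 0 := by
  ext p q
  rw [block_apply, blockScalar]
  split_ifs with h <;> simp [h]

theorem block_one (a b : Fin n) :
    block (1 : Matrix (Fin (2 * n)) (Fin (2 * n)) ℝ) a b = if a = b then 1 else 0 := by
  ext p q
  rw [block_apply, Matrix.one_apply]
  by_cases h : a = b <;> simp [h, Matrix.one_apply]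

theorem raisesLevel_iff_block {M : Matrix (Fin (2 * n)) (Fin (2 * n)) ℝ} {k : ℕ} :
    RaisesLevel (fun i => (i : ℕ) / 2) k M ↔ ∀ a b : Fin n, (a : ℕ) < b + k → block M a b = 0 := by
  constructor
  · intro h a b hab
    ext p q
    rw [block_apply]
    exact h _ _ (by simpa only [blockIndex_val_div] using hab)
  · intro h i j hij
    obtain ⟨⟨a, p⟩, rfl⟩ := blockIndex.surjective i
    obtain ⟨⟨b, q⟩, rfl⟩ := blockIndex.surjective j
    simp only [blockIndex_val_div] at hij
    exact (block_apply M a b p q).symm.trans (congrFun₂ (h a b hij) p q)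

theorem blockScalar_mul_self (n : ℕ) :
    blockScalar n !![0, 1; -1, 0] * blockScalar n !![0, 1; -1, 0] = -1 := by
  refine ext_block fun a b => ?_
  have hneg : block (-1 : Matrix (Fin (2 * n)) (Fin (2 * n)) ℝ) a b = -block 1 a b := rfl
  rw [block_mul, hneg, block_one]
  simp only [block_blockScalar, ite_mul, zero_mul, Finset.sum_ite_eq, Finset.mem_univ, if_true]
  by_cases h : a = b
  · simp [h, Matrix.one_fin_two]
  · simp [h]

/-- The action of the complex scalars by block diagonal matrices. -/
noncomputable def complexScalar (n : ℕ) : ℂ →ₐ[ℝ] Matrix (Fin (2 * n)) (Fin (2 * n)) ℝ :=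
  Complex.liftAux (blockScalar n !![0, 1; -1, 0]) (blockScalar_mul_self n)

theorem block_complexScalar (z : ℂ) (a b : Fin n) :
    block (complexScalar n z) a b = if a = b then !![z.re, z.im; -z.im, z.re] else 0 := by
  rw [complexScalar, Complex.liftAux_apply, Algebra.algebraMap_eq_smul_one]
  have h : block (z.re • (1 : Matrix (Fin (2 * n)) (Fin (2 * n)) ℝ) +
      z.im • blockScalar n !![0, 1; -1, 0]) a b =
      z.re • block 1 a b + z.im • block (blockScalar n !![0, 1; -1, 0]) a b := rfl
  rw [h, block_one, block_blockScalar]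
  split_ifs <;> simp [Matrix.one_fin_two]

theorem raisesLevel_complexScalar (z : ℂ) :
    RaisesLevel (fun i => (i : ℕ) / 2) 0 (complexScalar n z) :=
  raisesLevel_iff_block.2 fun a b hab => by
    rw [block_complexScalar, if_neg (by rintro rfl; simp at hab)]

theorem commute_of_mem_setS {C D : Matrix (Fin 2) (Fin 2) ℝ} (hC : C ∈ setS) (hD : D ∈ setS) :
    C * D = D * C := by
  obtain ⟨α, β, rfl⟩ := hC
  obtain ⟨γ, δ, rfl⟩ := hD
  simp only [Matrix.mul_fin_two]
  congr! 3 <;> ring_nf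

theorem setB_subset_levelSubalgebra (n : ℕ) :
    setB n ⊆ levelSubalgebra (fun i => (i : ℕ) / 2) (complexScalar n)
      raisesLevel_complexScalar := by
  rintro M ⟨_, ⟨α, β, rfl⟩, hdiag, hup, hlow⟩
  have hS : ∀ a b, block M a b ∈ setS := by
    intro a b
    rcases lt_trichotomy a b with h | rfl | h
    · exact ⟨0, 0, by rw [hup a b h]; ext i j; fin_cases i <;> fin_cases j <;> simp⟩
    · exact ⟨α, β, hdiag a⟩
    · exact hlow a b h
  refine ⟨fun z => ext_block fun a b => ?_, ⟨α, β⟩, raisesLevel_iff_block.2 fun a b hab => ?_⟩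
  · simp only [block_mul, block_complexScalar, ite_mul, mul_ite, zero_mul, mul_zero,
      Finset.sum_ite_eq, Finset.sum_ite_eq', Finset.mem_univ, if_true]
    exact commute_of_mem_setS ⟨_, _, rfl⟩ (hS a b)
  · have h : block (M - complexScalar n ⟨α, β⟩) a b =
      block M a b - block (complexScalar n ⟨α, β⟩) a b := rfl
    rw [h, block_complexScalar]
    rcases (show a ≤ b from Fin.le_def.2 (by omega)).lt_or_eq with hlt | rfl
    · rw [hup a b hlt, if_neg hlt.ne, sub_zero]
    · rw [hdiag, if_pos rfl, sub_self]

theorem complexScalar_apply_zero (hn : 0 < 2 * n) (z : ℂ) :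
    complexScalar n z ⟨0, hn⟩ ⟨0, hn⟩ = z.re := by
  have h := congrFun₂ (block_complexScalar z (⟨0, by omega⟩ : Fin n) ⟨0, by omega⟩) 0 0
  simpa [block] using h

end Blocks

/-! ### The real triangular case -/

section Triangular

variable {n : ℕ}

theorem raisesLevel_algebraMap (z : ℝ) :
    RaisesLevel (fun i : Fin n => (i : ℕ)) 0
      (Algebra.ofId ℝ (Matrix (Fin n) (Fin n) ℝ) z) := fun i j hij => by
  rw [Algebra.ofId_apply, Matrix.algebraMap_matrix_apply, if_neg]
  rintro rfl
  simp at hij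

theorem setT_subset_levelSubalgebra (n : ℕ) :
    setT n ⊆ levelSubalgebra (fun i => (i : ℕ)) (Algebra.ofId ℝ (Matrix (Fin n) (Fin n) ℝ))
      raisesLevel_algebraMap := by
  rintro M ⟨μ, hdiag, hup⟩
  refine ⟨fun z => Algebra.commutes z M, μ, fun i j hij => ?_⟩
  rw [Algebra.ofId_apply, Matrix.sub_apply, Matrix.algebraMap_matrix_apply]
  rcases (show i ≤ j from Nat.le_of_lt_succ hij).lt_or_eq with hlt | rfl
  · rw [hup i j hlt, if_neg hlt.ne, sub_zero]
  · simp [hdiag]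

theorem exists_neg_of_indexT_eq_one {G : Subgroup (GL (Fin n) ℝ)} (h : indexT G = 1) :
    ∃ A ∈ G, ∃ μ < 0, IsLowerTriangularWith μ (A : Matrix (Fin n) (Fin n) ℝ) := by
  rw [indexT, signIndex] at h
  split_ifs at h with h'
  obtain ⟨μ, ⟨A, hA, hAμ⟩, hμ⟩ := h'
  exact ⟨A, hA, μ 0, hμ, hAμ⟩

theorem mulVec_mem_closure_orbit {m : ℕ} {G : Subgroup (GL (Fin m) ℝ)} {A : GL (Fin m) ℝ}
    (hA : A ∈ G) {u y : Fin m → ℝ} (hy : y ∈ closure (orbit G u)) :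
    (A : Matrix (Fin m) (Fin m) ℝ) *ᵥ y ∈ closure (orbit G u) := by
  refine map_mem_closure (f := fun y => (A : Matrix (Fin m) (Fin m) ℝ) *ᵥ y) (by fun_prop) hy ?_
  rintro _ ⟨B, hB, rfl⟩
  exact ⟨A * B, G.mul_mem hA hB, by simp [Matrix.mulVec_mulVec]⟩

theorem mulVec_apply_zero {M : Matrix (Fin n) (Fin n) ℝ} {μ : ℝ} (hM : IsLowerTriangularWith μ M)
    (hn : 0 < n) (y : Fin n → ℝ) : (M *ᵥ y) ⟨0, hn⟩ = μ * y ⟨0, hn⟩ := by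
  rw [Matrix.mulVec, dotProduct, Finset.sum_eq_single ⟨0, hn⟩, hM.1]
  · intro j _ hj
    rw [hM.2 _ j (Fin.lt_def.2 (Nat.pos_of_ne_zero fun h => hj (Fin.ext h))), zero_mul]
  · simp

end Triangular

theorem dense_of_ne_zero_subset_closure {m : ℕ} (i : Fin m) {s : Set (Fin m → ℝ)}
    (h : ∀ x : Fin m → ℝ, x i ≠ 0 → x ∈ closure s) : Dense s := by
  have h1 : Dense (Function.eval i ⁻¹' ({0}ᶜ : Set ℝ) : Set (Fin m → ℝ)) :=
    (dense_compl_singleton (0 : ℝ)).preimage (isOpenMap_eval i)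
  exact dense_closure.1 (h1.mono h)

end AbelianLinear

/-! ### Density of the orbit of the first basis vector -/

open AbelianLinear in
theorem topologicallyTransitive_of_dense_evalSet_setB (n : ℕ) (hm : 1 ≤ 2 * n)
    (G : Subgroup (GL (Fin (2 * n)) ℝ)) (hG : ∀ A ∈ G, ∀ B ∈ G, A * B = B * A)
    (hd : Dense (evalSet (logSet (setB n) G) (firstBasisVector (2 * n) hm))) :
    TopologicallyTransitive G := by
  refine ⟨firstBasisVector (2 * n) hm, dense_of_ne_zero_subset_closure ⟨0, hm⟩ fun x hx => ?_⟩
  refine mem_closure_orbit_of_level (complexScalar n) raisesLevel_complexScalar ⟨0, hm⟩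
    (complexScalar_apply_zero hm) G hG (setB n) (setB_subset_levelSubalgebra n) hd x
    fun z hz => ⟨Complex.log z, ?_⟩
  rw [← Complex.exp_eq_exp_ℂ, Complex.exp_log]
  rintro rfl
  exact hx (by simpa using hz.symm)

open AbelianLinear in
theorem topologicallyTransitive_of_dense_evalSet_setT (n : ℕ) (hn : 1 ≤ n)
    (G : Subgroup (GL (Fin n) ℝ)) (hG : ∀ A ∈ G, ∀ B ∈ G, A * B = B * A)
    (hd : Dense (evalSet (logSet (setT n) G) (firstBasisVector n hn)))
    (hind : indexT G = 1) : TopologicallyTransitive G := by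
  have hpos : ∀ x : Fin n → ℝ, 0 < x ⟨0, hn⟩ →
      x ∈ closure (orbit G (firstBasisVector n hn)) := by
    refine fun x hx => mem_closure_orbit_of_level (Algebra.ofId ℝ _) raisesLevel_algebraMap
      ⟨0, hn⟩ (fun z => ?_) G hG _ (setT_subset_levelSubalgebra n) hd x
      fun z hz => ⟨Real.log z, ?_⟩
    · rw [Algebra.ofId_apply, Matrix.algebraMap_matrix_apply, if_pos rfl]; rfl
    · rw [← Real.exp_eq_exp_ℝ, Real.exp_log]
      exact hx.trans_eq hz.symm
  obtain ⟨A, hA, μ, hμ, hAμ⟩ := exists_neg_of_indexT_eq_one hind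
  refine ⟨firstBasisVector n hn, dense_of_ne_zero_subset_closure ⟨0, hn⟩ fun x hx => ?_⟩
  -- `A` multiplies the first coordinate by `μ < 0`, so `A⁻¹ x` lies in the half-space already
  -- covered, and the orbit closure is stable under `A`.
  rcases hx.lt_or_gt with hneg | h
  · have hxA : x = (A : Matrix (Fin n) (Fin n) ℝ) *ᵥ
        ((A⁻¹ : GL (Fin n) ℝ) : Matrix (Fin n) (Fin n) ℝ) *ᵥ x := by
      rw [Matrix.mulVec_mulVec, Units.mul_inv, Matrix.one_mulVec]
    rw [hxA, mulVec_apply_zero hAμ] at hneg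
    rw [hxA]
    exact mulVec_mem_closure_orbit hA (hpos _ (pos_of_mul_neg_right hneg hμ.le))
  · exact hpos x h

theorem corollary1p3 (n : ℕ) (hn : 1 ≤ n) :
    (∀ G : Subgroup (GL (Fin (2 * n)) ℝ),
      (∀ A ∈ G, ∀ B ∈ G, A * B = B * A) →
      (G : Set (GL (Fin (2 * n)) ℝ)) ⊆ AbelianLinear.setBStar n →
      Dense (AbelianLinear.evalSet (AbelianLinear.logSet (AbelianLinear.setB n) G)
        (AbelianLinear.firstBasisVector (2 * n) (by omega))) →
      AbelianLinear.TopologicallyTransitive G) ∧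
    (∀ G : Subgroup (GL (Fin n) ℝ),
      (∀ A ∈ G, ∀ B ∈ G, A * B = B * A) →
      (G : Set (GL (Fin n) ℝ)) ⊆ AbelianLinear.setTStar n →
      Dense (AbelianLinear.evalSet (AbelianLinear.logSet (AbelianLinear.setT n) G)
        (AbelianLinear.firstBasisVector n hn)) →
      AbelianLinear.indexT G = 1 →
      AbelianLinear.TopologicallyTransitive G) :=
  ⟨fun G hG _ hd => topologicallyTransitive_of_dense_evalSet_setB n _ G hG hd,
    fun G hG _ hd hind => topologicallyTransitive_of_dense_evalSet_setT n hn G hG hd hind⟩
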